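/- Let $\Sigma=\{0,1\}^{\mathbb Z_+}$ (with $\mathbb Z_+=\{0,1,2,\dots\}$) carry the product topology, let $d$ be any metric inducing this topology (none of the notions below depends on its choice), and let $\sigma:\Sigma\to\Sigma$, $\sigma(x)_n=x_{n+1}$, be the shift. A set $F\subset\mathbb Z_+$ has Banach density one if for every $\lambda<1$ there is $N\ge 1$ such that $\#(F\cap I)\ge\lambda\,\#(I)$ for every finite interval $I\subset\mathbb Z_+$ with $\#(I)\ge N$. A pair $(x,y)\in\Sigma^2$ is Banach proximal if for every $\varepsilon>0$ the set $\{n\in\mathbb Z_+: d(\sigma^n x,\sigma^n y)<\varepsilon\}$ has Banach density one, and asymptotic if $\lim_{n\to\infty}d(\sigma^n x,\sigma^n y)=0$. A set $S\subset\Sigma$ with at least two points is Banach scrambled if any two distinct points of $S$ form a Banach proximal pair that is not asymptotic. A Mycielski set is a countable union of Cantor sets (subsets homeomorphic to $\{0,1\}^{\mathbb N}$). Then there is a dense Mycielski set $S\subset\Sigma$ with $\sigma(S)\subset S$ that is Banach scrambled. Moreover, the Banach proximal relation $\{(x,y)\in\Sigma^2:(x,y)\text{ is Banach proximal}\}$ is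 of first category in $\Sigma\times\Sigma$. -/

import Mathlib

/-- A set `F` of non-negative integers has Banach density one: for every `l < 1` there is `N ≥ 1`
such that `#(F ∩ I) ≥ l * #I` for every interval `I = {a, …, a + k - 1}` with `#I = k ≥ N`. -/
def HasBanachDensityOne (F : Set ℕ) : Prop :=
  ∀ l : ℝ, l < 1 → ∃ N : ℕ, 1 ≤ N ∧ ∀ a k : ℕ, N ≤ k →
    l * (k : ℝ) ≤ ((F ∩ Set.Ico a (a + k)).ncard : ℝ)

/-- The pair `(x, y)` is Banach proximal for `T`. -/
def IsBanachProximal {X : Type*} [MetricSpace X] (T : X → X) (x y : X) : Prop :=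
  ∀ ε : ℝ, 0 < ε → HasBanachDensityOne {n : ℕ | dist (T^[n] x) (T^[n] y) < ε}

/-- The pair `(x, y)` is asymptotic for `T`. -/
def IsAsymptoticPair {X : Type*} [MetricSpace X] (T : X → X) (x y : X) : Prop :=
  Filter.Tendsto (fun n : ℕ => dist (T^[n] x) (T^[n] y)) Filter.atTop (nhds 0)

/-- The Banach proximal relation of `T`. -/
def banachProximalRelation {X : Type*} [MetricSpace X] (T : X → X) : Set (X × X) :=
  {p | IsBanachProximal T p.1 p.2}

/-- A set with at least two points, any two distinct points of which form a Banach proximal pair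
that is not asymptotic. -/
def IsBanachScrambled {X : Type*} [MetricSpace X] (T : X → X) (S : Set X) : Prop :=
  S.Nontrivial ∧ ∀ x ∈ S, ∀ y ∈ S, x ≠ y → IsBanachProximal T x y ∧ ¬ IsAsymptoticPair T x y

/-- A Cantor set: a subset homeomorphic to the Cantor space `{0,1}^ℕ`. -/
def IsCantorSubset {X : Type*} [TopologicalSpace X] (C : Set X) : Prop :=
  Nonempty (C ≃ₜ (ℕ → Bool))

/-- A Mycielski set: a countable union of Cantor sets. -/
def IsMycielskiSet {X : Type*} [TopologicalSpace X] (K : Set X) : Prop :=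
  ∃ C : ℕ → Set X, (∀ i, IsCantorSubset (C i)) ∧ K = ⋃ i, C i

/-- The shift map on `{0,1}^ℕ` (indices starting at `0`). -/
def fullShift (x : ℕ → Bool) : ℕ → Bool := fun n => x (n + 1)

/-- The metric `m` induces the product topology on `{0,1}^ℕ`. -/
def IsCompatibleMetric (m : MetricSpace (ℕ → Bool)) : Prop :=
  m.toPseudoMetricSpace.toUniformSpace.toTopologicalSpace =
    (Pi.topologicalSpace : TopologicalSpace (ℕ → Bool))

/-! The scrambled set consists of all shifts of the points `sparsePoint w a`: a free finite prefix
`w`, which gives density, then ones only at positions `2 ^ c` with `c` coding `w` and a prefix of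
`a`. Powers of two have Banach density zero, so any two such points are Banach proximal, both being
zero on long windows most of the time. Conversely the far ones determine everything: the codes
reveal `w` and `a`, and the growing gaps between powers of two reveal the shift
(`eq_of_eventually_shift_sparsePoint_eq`). Hence distinct points are not asymptotic, and for fixed
shift and `w` the map from `a` is a continuous injection, with a Cantor set as image.

For meagreness, a Banach proximal pair agrees somewhere in every window of some fixed length, a
closed condition with empty interior. -/

/-! ### Sets of Banach density one -/

namespace HasBanachDensityOne

theorem mono {F G : Set ℕ} (hF : HasBanachDensityOne F) (h : F ⊆ G) :
    HasBanachDensityOne G := by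
  intro l hl
  obtain ⟨N, hN, H⟩ := hF l hl
  refine ⟨N, hN, fun a k hk => (H a k hk).trans ?_⟩
  exact_mod_cast Set.ncard_le_ncard (Set.inter_subset_inter_left _ h)
    ((Set.finite_Ico _ _).inter_of_right _)

theorem univ : HasBanachDensityOne Set.univ := by
  intro l hl
  refine ⟨1, le_rfl, fun a k _ => ?_⟩
  have : (Set.univ ∩ Set.Ico a (a + k)).ncard = k := by
    rw [Set.univ_inter, ← Finset.coe_Ico, Set.ncard_coe_finset]
    simp
  rw [this]
  exact mul_le_of_le_one_left (Nat.cast_nonneg k) hl.le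

theorem inter {F G : Set ℕ} (hF : HasBanachDensityOne F) (hG : HasBanachDensityOne G) :
    HasBanachDensityOne (F ∩ G) := by
  intro l hl
  -- Inclusion-exclusion leaves density `2 * ((1 + l) / 2) - 1 = l`.
  obtain ⟨N, hN, H⟩ := hF ((1 + l) / 2) (by linarith)
  obtain ⟨M, -, K⟩ := hG ((1 + l) / 2) (by linarith)
  refine ⟨max N M, hN.trans (le_max_left _ _), fun a k hk => ?_⟩
  have h₁ := H a k ((le_max_left _ _).trans hk)
  have h₂ := K a k ((le_max_right _ _).trans hk)
  set I := Set.Ico a (a + k)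
  have hI : I.Finite := Set.finite_Ico _ _
  have hk : I.ncard = k := by
    simp only [I]
    rw [← Finset.coe_Ico, Set.ncard_coe_finset]
    simp
  have h₃ := Set.ncard_union_add_ncard_inter (F ∩ I) (G ∩ I)
    (hI.inter_of_right _) (hI.inter_of_right _)
  rw [← Set.inter_inter_distrib_right] at h₃
  have h₄ : ((F ∩ I) ∪ (G ∩ I)).ncard ≤ k := by
    rw [← hk]
    exact Set.ncard_le_ncard (by intro x hx; rcases hx with hx | hx <;> exact hx.2) hI
  have h₅ : ((F ∩ I).ncard : ℝ) + ((G ∩ I).ncard : ℝ) ≤ k + ((F ∩ G ∩ I).ncard : ℝ) := by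
    exact_mod_cast h₃ ▸ Nat.add_le_add_right h₄ _
  linarith

theorem preimage_add {F : Set ℕ} (hF : HasBanachDensityOne F) (j : ℕ) :
    HasBanachDensityOne {n | n + j ∈ F} := by
  intro l hl
  obtain ⟨N, hN, H⟩ := hF l hl
  refine ⟨N, hN, fun a k hk => (H (a + j) k hk).trans ?_⟩
  have : F ∩ Set.Ico (a + j) (a + j + k) ⊆
      (fun n => n + j) '' ({n | n + j ∈ F} ∩ Set.Ico a (a + k)) := by
    rintro x ⟨hx, h₁, h₂⟩
    have hj : x - j + j = x := by omega
    refine ⟨x - j, ⟨?_, ?_, ?_⟩, hj⟩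
    · simpa [hj] using hx
    · omega
    · omega
  have hfin : ({n | n + j ∈ F} ∩ Set.Ico a (a + k)).Finite :=
    (Set.finite_Ico _ _).inter_of_right _
  exact_mod_cast (Set.ncard_le_ncard this (hfin.image _)).trans (Set.ncard_image_le hfin)

theorem forall_lt_add_mem {F : Set ℕ} (hF : HasBanachDensityOne F) (N : ℕ) :
    HasBanachDensityOne {n | ∀ i < N, n + i ∈ F} := by
  induction N with
  | zero => exact univ.mono (by simp)
  | succ N ih =>
    refine (ih.inter (hF.preimage_add N)).mono ?_
    rintro n ⟨h₁, h₂⟩ i hi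
    rcases Nat.lt_succ_iff_lt_or_eq.1 hi with h | rfl
    · exact h₁ i h
    · exact h₂

/-- A set whose complement meets each interval of length `k` in at most `g k = o(k)` points. -/
theorem of_ncard_compl_le {F : Set ℕ} (g : ℕ → ℝ)
    (hg : g =o[Filter.atTop] (fun k : ℕ => (k : ℝ)))
    (h : ∀ a k : ℕ, ((Fᶜ ∩ Set.Ico a (a + k)).ncard : ℝ) ≤ g k) :
    HasBanachDensityOne F := by
  intro l hl
  obtain ⟨N, hN⟩ := Filter.eventually_atTop.1 (hg.bound (sub_pos.2 hl))
  refine ⟨max N 1, le_max_right _ _, fun a k hk => ?_⟩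
  have h₁ := hN k ((le_max_left _ _).trans hk)
  rw [Real.norm_natCast] at h₁
  have h₂ := (h a k).trans ((Real.le_norm_self _).trans h₁)
  have hI : (Set.Ico a (a + k)).Finite := Set.finite_Ico _ _
  have hk : (Set.Ico a (a + k)).ncard = k := by
    rw [← Finset.coe_Ico, Set.ncard_coe_finset]
    simp
  have h₃ : k ≤ (F ∩ Set.Ico a (a + k)).ncard + (Fᶜ ∩ Set.Ico a (a + k)).ncard := by
    conv_lhs => rw [← hk]
    refine (Set.ncard_le_ncard ?_ ((hI.inter_of_right _).union (hI.inter_of_right _))).trans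
      (Set.ncard_union_le _ _)
    intro x hx
    by_cases hF : x ∈ F
    · exact Or.inl ⟨hF, hx⟩
    · exact Or.inr ⟨hF, hx⟩
  have h₄ : (k : ℝ) ≤ ((F ∩ Set.Ico a (a + k)).ncard : ℝ) +
      ((Fᶜ ∩ Set.Ico a (a + k)).ncard : ℝ) := by exact_mod_cast h₃
  linarith

theorem compl_of_finite {B : Set ℕ} (hB : B.Finite) : HasBanachDensityOne Bᶜ := by
  refine of_ncard_compl_le (fun _ => (B.ncard : ℝ)) ?_ fun a k => ?_
  · exact Asymptotics.isLittleO_const_left.2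
      (Or.inr (by simpa [Function.comp_def] using tendsto_natCast_atTop_atTop (R := ℝ)))
  · rw [compl_compl]
    exact_mod_cast Set.ncard_le_ncard Set.inter_subset_left hB

end HasBanachDensityOne

/-! ### Powers of two have Banach density zero -/

theorem ncard_range_two_pow_inter_Ico_le (a k : ℕ) :
    (Set.range (fun t : ℕ => 2 ^ t) ∩ Set.Ico a (a + k)).ncard ≤ Nat.log 2 k + 2 := by
  set P := Set.range (fun t : ℕ => 2 ^ t) ∩ Set.Ico a (a + k)
  have hsplit : P ⊆ (P ∩ Set.Iio k) ∪ (P ∩ Set.Ici k) := by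
    intro x hx
    rcases lt_or_ge x k with h | h
    · exact Or.inl ⟨hx, h⟩
    · exact Or.inr ⟨hx, h⟩
  have hP : P.Finite := (Set.finite_Ico _ _).inter_of_right _
  have hsmall : (P ∩ Set.Iio k).ncard ≤ Nat.log 2 k + 1 := by
    have : P ∩ Set.Iio k ⊆
        (((Finset.range (Nat.log 2 k + 1)).image (fun t : ℕ => 2 ^ t) : Finset ℕ) : Set ℕ) := by
      rintro x ⟨⟨⟨t, rfl⟩, -⟩, hx⟩
      simp only [Finset.coe_image, Set.mem_image, Finset.coe_range, Set.mem_Iio] at hx ⊢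
      exact ⟨t, Nat.lt_succ_of_le (Nat.le_log_of_pow_le one_lt_two hx.le), rfl⟩
    refine (Set.ncard_le_ncard this (Finset.finite_toSet _)).trans ?_
    rw [Set.ncard_coe_finset]
    exact Finset.card_image_le.trans (by simp)
  -- Distinct powers of two that are at least `k` differ by at least `k`, too much for one window.
  have hlarge : (P ∩ Set.Ici k).ncard ≤ 1 := by
    rw [Set.ncard_le_one (hP.subset Set.inter_subset_left)]
    have key : ∀ s t : ℕ, s < t → 2 ^ s ∈ P ∩ Set.Ici k → 2 ^ t ∈ P ∩ Set.Ici k → False := by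
      rintro s t hst ⟨⟨-, h₁, -⟩, h₂⟩ ⟨⟨-, -, h₃⟩, -⟩
      have := Nat.pow_le_pow_right (n := 2) two_pos (Nat.succ_le_of_lt hst)
      rw [Nat.succ_eq_add_one, pow_succ] at this
      rw [Set.mem_Ici] at h₂
      omega
    intro x hx y hy
    obtain ⟨⟨⟨s, rfl⟩, -⟩, -⟩ := id hx
    obtain ⟨⟨⟨t, rfl⟩, -⟩, -⟩ := id hy
    rcases lt_trichotomy s t with h | h | h
    · exact (key s t h hx hy).elim
    · rw [h]
    · exact (key t s h hy hx).elim
  calc P.ncard ≤ _ := Set.ncard_le_ncard hsplit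
        ((hP.subset Set.inter_subset_left).union (hP.subset Set.inter_subset_left))
    _ ≤ _ := Set.ncard_union_le _ _
    _ ≤ _ := by omega

theorem hasBanachDensityOne_compl_range_two_pow :
    HasBanachDensityOne (Set.range (fun t : ℕ => 2 ^ t))ᶜ := by
  refine HasBanachDensityOne.of_ncard_compl_le
    (fun k => Real.log k / Real.log 2 + 2) ?_ fun a k => ?_
  · have hcast := tendsto_natCast_atTop_atTop (R := ℝ)
    refine Asymptotics.IsLittleO.add ?_ ?_
    · have := (Real.isLittleO_log_id_atTop.comp_tendsto hcast).const_mul_left (Real.log 2)⁻¹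
      simpa [Function.comp_def, div_eq_inv_mul] using this
    · exact Asymptotics.isLittleO_const_left.2 (Or.inr (by simpa [Function.comp_def] using hcast))
  · rw [compl_compl]
    have h₁ : ((Nat.log 2 k : ℕ) : ℝ) ≤ Real.log k / Real.log 2 := by
      simpa [Real.logb] using Real.natLog_le_logb k 2
    have h₂ : ((Set.range (fun t : ℕ => 2 ^ t) ∩ Set.Ico a (a + k)).ncard : ℝ) ≤
        Nat.log 2 k + 2 := by exact_mod_cast ncard_range_two_pow_inter_Ico_le a k
    linarith

/-! ### The shift and compatible metrics -/

theorem fullShift_iterate_apply (k : ℕ) (x : ℕ → Bool) (n : ℕ) :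
    fullShift^[k] x n = x (n + k) := by
  induction k generalizing x with
  | zero => rfl
  | succ k ih =>
    rw [Function.iterate_succ_apply, ih, fullShift]
    rfl

theorem continuous_fullShift_iterate (k : ℕ) : Continuous fullShift^[k] := by
  refine continuous_pi fun n => ?_
  simp only [fullShift_iterate_apply]
  exact continuous_apply _

namespace IsCompatibleMetric

/-- A compact Hausdorff space has only one compatible uniformity, which is why the choice of metric
is immaterial. -/
theorem uniformSpace_eq {m : MetricSpace (ℕ → Bool)} (hm : IsCompatibleMetric m) :
    m.toPseudoMetricSpace.toUniformSpace = Pi.uniformSpace fun _ : ℕ => Bool :=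
  unique_uniformity_of_compact (t := Pi.topologicalSpace) hm rfl

theorem exists_forall_dist_lt {m : MetricSpace (ℕ → Bool)} (hm : IsCompatibleMetric m)
    {ε : ℝ} (hε : 0 < ε) :
    ∃ N : ℕ, ∀ x y : ℕ → Bool, (∀ i < N, x i = y i) → m.dist x y < ε := by
  have h : {p : (ℕ → Bool) × (ℕ → Bool) | m.dist p.1 p.2 < ε} ∈
      @uniformity _ m.toPseudoMetricSpace.toUniformSpace :=
    @Metric.dist_mem_uniformity _ m.toPseudoMetricSpace ε hε
  rw [hm.uniformSpace_eq, Pi.uniformity (α := fun _ : ℕ => Bool), Filter.mem_iInf] at h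
  obtain ⟨I, hI, V, hV, hVeq⟩ := h
  obtain ⟨N, hN⟩ := hI.bddAbove
  refine ⟨N + 1, fun x y hxy => ?_⟩
  have : (x, y) ∈ {p : (ℕ → Bool) × (ℕ → Bool) | m.dist p.1 p.2 < ε} := by
    rw [hVeq, Set.mem_iInter]
    intro i
    obtain ⟨U, hU, hUV⟩ := hV i
    apply hUV
    change (x i, y i) ∈ U
    rw [hxy i (Nat.lt_succ_of_le (hN i.2))]
    exact refl_mem_uniformity hU
  exact this

theorem exists_dist_lt_imp {m : MetricSpace (ℕ → Bool)} (hm : IsCompatibleMetric m) :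
    ∃ δ : ℝ, 0 < δ ∧ ∀ x y : ℕ → Bool, m.dist x y < δ → x 0 = y 0 := by
  have h : {p : (ℕ → Bool) × (ℕ → Bool) | p.1 0 = p.2 0} ∈
      @uniformity _ m.toPseudoMetricSpace.toUniformSpace := by
    rw [hm.uniformSpace_eq, Pi.uniformity (α := fun _ : ℕ => Bool)]
    refine Filter.mem_iInf_of_mem 0 ⟨SetRel.id, ?_, fun p hp => hp⟩
    exact Filter.mem_principal_self _
  obtain ⟨δ, hδ, H⟩ := (@Metric.mem_uniformity_dist _ m.toPseudoMetricSpace _).1 h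
  exact ⟨δ, hδ, fun x y hxy => H hxy⟩

/-- Two sequences whose ones have Banach density zero form a Banach proximal pair. -/
theorem isBanachProximal {m : MetricSpace (ℕ → Bool)} (hm : IsCompatibleMetric m)
    {x y : ℕ → Bool} (hx : HasBanachDensityOne {n | x n = false})
    (hy : HasBanachDensityOne {n | y n = false}) :
    @IsBanachProximal _ m fullShift x y := by
  intro ε hε
  obtain ⟨N, hN⟩ := hm.exists_forall_dist_lt hε
  refine ((hx.inter hy).forall_lt_add_mem N).mono fun n hn => hN _ _ fun i hi => ?_
  have h := hn i hi
  rw [fullShift_iterate_apply, fullShift_iterate_apply, add_comm i n]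
  exact h.1.trans h.2.symm

theorem eventually_eq_of_isAsymptoticPair {m : MetricSpace (ℕ → Bool)}
    (hm : IsCompatibleMetric m) {x y : ℕ → Bool}
    (h : @IsAsymptoticPair _ m fullShift x y) : ∀ᶠ n in Filter.atTop, x n = y n := by
  obtain ⟨δ, hδ, H⟩ := hm.exists_dist_lt_imp
  filter_upwards [h.eventually (gt_mem_nhds hδ)] with n hn
  simpa [fullShift_iterate_apply] using H _ _ hn

theorem hasBanachDensityOne_of_isBanachProximal {m : MetricSpace (ℕ → Bool)}
    (hm : IsCompatibleMetric m) {x y : ℕ → Bool}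
    (h : @IsBanachProximal _ m fullShift x y) : HasBanachDensityOne {n | x n = y n} := by
  obtain ⟨δ, hδ, H⟩ := hm.exists_dist_lt_imp
  refine (h δ hδ).mono fun n hn => ?_
  simpa [fullShift_iterate_apply] using H _ _ hn

end IsCompatibleMetric

/-! ### Sparse points and their rigidity -/

/-- A natural number coding the word `w` together with the first `n` symbols of `a`. -/
def prefixCode (w : List Bool) (a : ℕ → Bool) (n : ℕ) : ℕ :=
  Encodable.encode ((w, ⟨n, fun i => a i⟩) : List Bool × (Σ k : ℕ, Fin k → Bool))

theorem prefixCode_inj {w v : List Bool} {a b : ℕ → Bool} {n k : ℕ}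
    (h : prefixCode w a n = prefixCode v b k) : w = v ∧ n = k ∧ ∀ i < n, a i = b i := by
  have h := Encodable.encode_injective h
  rw [Prod.mk.injEq, Sigma.mk.injEq] at h
  obtain ⟨hw, rfl, hab⟩ := h
  exact ⟨hw, rfl, fun i hi => congrFun (eq_of_heq hab) ⟨i, hi⟩⟩

theorem tendsto_prefixCode (w : List Bool) (a : ℕ → Bool) :
    Filter.Tendsto (prefixCode w a) Filter.atTop Filter.atTop :=
  Function.Injective.nat_tendsto_atTop fun _ _ h => (prefixCode_inj h).2.1

open Classical in
/-- The sequence beginning with `w`, and whose later ones sit at the positions `2 ^ c` for `c` a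
code of `w` and a prefix of `a`. -/
noncomputable def sparsePoint (w : List Bool) (a : ℕ → Bool) : ℕ → Bool := fun m =>
  w.getD m (decide (∃ n, 2 ^ prefixCode w a n = m))

theorem sparsePoint_of_lt {w : List Bool} (a : ℕ → Bool) {m : ℕ} (h : m < w.length) :
    sparsePoint w a m = w[m] := by
  simp [sparsePoint, h]

theorem sparsePoint_eq_true_iff {w : List Bool} {a : ℕ → Bool} {m : ℕ} (h : w.length ≤ m) :
    sparsePoint w a m = true ↔ ∃ n, 2 ^ prefixCode w a n = m := by
  simp [sparsePoint, h]

/-- Each coordinate is locally constant in `a`: past `w`, it tests at most one coded prefix of `a`.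
-/
theorem continuous_sparsePoint (w : List Bool) : Continuous (sparsePoint w) := by
  refine continuous_pi fun m => ?_
  rcases lt_or_ge m w.length with h | h
  · simp only [sparsePoint_of_lt _ h]
    exact continuous_const
  · refine IsLocallyConstant.continuous ((IsLocallyConstant.iff_eventually_eq _).2 fun a => ?_)
    by_cases hm : ∃ b n, 2 ^ prefixCode w b n = m
    · obtain ⟨b, n, hbn⟩ := hm
      have hiff : ∀ c, sparsePoint w c m = true ↔ ∀ i < n, c i = b i := by
        intro c
        rw [sparsePoint_eq_true_iff h, ← hbn]
        constructor
        · rintro ⟨k, hk⟩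
          obtain ⟨-, rfl, hc⟩ := prefixCode_inj (Nat.pow_right_injective le_rfl hk)
          exact hc
        · intro hc
          refine ⟨n, congrArg (fun t => 2 ^ t) ?_⟩
          have : (fun i : Fin n => c i) = fun i : Fin n => b i := funext fun i => hc i i.2
          rw [prefixCode, prefixCode, this]
      have hc : ∀ᶠ c in nhds a, ∀ i ∈ {i | i < n}, c i = a i :=
        (Filter.eventually_all_finite (Set.finite_lt_nat n)).2 fun i _ =>
          (continuous_apply i).continuousAt.eventually_mem
            (by simp [nhds_discrete] : {a i} ∈ nhds (a i))
      filter_upwards [hc] with c hc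
      rw [Bool.eq_iff_iff, hiff, hiff]
      exact forall₂_congr fun i hi => by rw [hc i hi]
    · have hfalse : ∀ c, sparsePoint w c m = false := by
        intro c
        rw [← Bool.not_eq_true, sparsePoint_eq_true_iff h]
        exact fun hc => hm ⟨c, hc⟩
      exact Filter.Eventually.of_forall fun c => by rw [hfalse, hfalse]

theorem hasBanachDensityOne_sparsePoint (w : List Bool) (a : ℕ → Bool) :
    HasBanachDensityOne {n | sparsePoint w a n = false} := by
  refine (hasBanachDensityOne_compl_range_two_pow.inter
    (HasBanachDensityOne.compl_of_finite (Set.finite_lt_nat w.length))).mono ?_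
  rintro m ⟨h₁, h₂⟩
  rw [Set.mem_compl_iff, Set.mem_ofPred_eq, not_lt] at h₂
  rw [Set.mem_ofPred_eq, ← Bool.not_eq_true, sparsePoint_eq_true_iff h₂]
  rintro ⟨n, hn⟩
  exact h₁ ⟨_, hn⟩

/-- A power of two other than `2 ^ c` is at distance at least `2 ^ c / 2` from it, more than the
shifts can compensate. -/
theorem two_pow_add_eq_two_pow_add {c d i j : ℕ} (hc : 2 * i + j < 2 ^ c)
    (h : 2 ^ c + j = 2 ^ d + i) : c = d := by
  rcases lt_trichotomy c d with hlt | heq | hlt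
  · have := Nat.pow_le_pow_right (n := 2) two_pos (Nat.succ_le_of_lt hlt)
    rw [Nat.succ_eq_add_one, pow_succ] at this
    omega
  · exact heq
  · have := Nat.pow_le_pow_right (n := 2) two_pos (Nat.succ_le_of_lt hlt)
    rw [Nat.succ_eq_add_one, pow_succ] at this
    omega

theorem eq_of_eventually_shift_sparsePoint_eq {w v : List Bool} {a b : ℕ → Bool} {i j : ℕ}
    (h : ∀ᶠ n in Filter.atTop,
      fullShift^[i] (sparsePoint w a) n = fullShift^[j] (sparsePoint v b) n) :
    i = j ∧ w = v ∧ a = b := by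
  simp only [fullShift_iterate_apply] at h
  obtain ⟨N, hN⟩ := Filter.eventually_atTop.1 h
  have key : ∀ᶠ n in Filter.atTop, i = j ∧ w = v ∧ ∀ k < n, a k = b k := by
    -- The bound leaves the position beyond `N` after subtracting `i`, beyond both prefixes, and
    -- large enough for the gap argument.
    filter_upwards [(tendsto_prefixCode w a).eventually_ge_atTop
      (N + 2 * i + j + w.length + v.length)] with n hn
    have hlt : prefixCode w a n < 2 ^ prefixCode w a n := Nat.lt_two_pow_self
    have h₁ : sparsePoint w a (2 ^ prefixCode w a n) = true :=
      (sparsePoint_eq_true_iff (by omega)).2 ⟨n, rfl⟩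
    have h₂ := hN (2 ^ prefixCode w a n - i) (by omega)
    rw [Nat.sub_add_cancel (by omega), h₁, eq_comm, sparsePoint_eq_true_iff (by omega)] at h₂
    obtain ⟨k, hk⟩ := h₂
    have hcode := two_pow_add_eq_two_pow_add (c := prefixCode w a n) (d := prefixCode v b k)
      (i := i) (j := j) (by omega) (by omega)
    obtain ⟨hw, -, hab⟩ := prefixCode_inj hcode
    rw [← hcode] at hk
    exact ⟨by omega, hw, hab⟩
  obtain ⟨n, hij, hw, -⟩ := key.exists
  refine ⟨hij, hw, funext fun k => ?_⟩
  obtain ⟨n, hn, hk⟩ := (key.and (Filter.eventually_gt_atTop k)).exists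
  exact hn.2.2 k hk

/-! ### The scrambled Mycielski set -/

theorem isCantorSubset_range {X : Type*} [TopologicalSpace X] [T2Space X] {f : (ℕ → Bool) → X}
    (hf : Continuous f) (hinj : Function.Injective f) : IsCantorSubset (Set.range f) :=
  ⟨((hf.isClosedEmbedding hinj).isEmbedding.toHomeomorph).symm⟩

/-- All the shifts of all the points `sparsePoint w a`. -/
def sparseSet : Set (ℕ → Bool) :=
  {x | ∃ i w a, fullShift^[i] (sparsePoint w a) = x}

theorem dense_of_forall_exists_prefix {S : Set (ℕ → Bool)}
    (h : ∀ (x : ℕ → Bool) (N : ℕ), ∃ y ∈ S, ∀ i < N, y i = x i) : Dense S := by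
  intro x
  choose y hy hyx using h x
  refine mem_closure_of_tendsto (f := y) (b := Filter.atTop) ?_ (Filter.Eventually.of_forall hy)
  rw [tendsto_pi_nhds]
  intro i
  refine tendsto_const_nhds.congr' ?_
  filter_upwards [Filter.eventually_gt_atTop i] with n hn
  exact (hyx n i hn).symm

theorem dense_sparseSet : Dense sparseSet := by
  refine dense_of_forall_exists_prefix fun x N => ?_
  refine ⟨sparsePoint ((List.range N).map x) x, ⟨0, _, _, rfl⟩, fun i hi => ?_⟩
  rw [sparsePoint_of_lt _ (by simpa using hi)]
  simp

theorem isMycielskiSet_sparseSet : IsMycielskiSet sparseSet := by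
  obtain ⟨e, he⟩ := exists_surjective_nat (ℕ × List Bool)
  refine ⟨fun k => Set.range fun a => fullShift^[(e k).1] (sparsePoint (e k).2 a),
    fun k => isCantorSubset_range ?_ fun a b hab => ?_, ?_⟩
  · exact (continuous_fullShift_iterate _).comp (continuous_sparsePoint _)
  · exact (eq_of_eventually_shift_sparsePoint_eq
      (Filter.Eventually.of_forall fun n => congrFun hab n)).2.2
  · ext x
    simp only [sparseSet, Set.mem_ofPred_eq, Set.mem_iUnion, Set.mem_range]
    constructor
    · rintro ⟨i, w, a, rfl⟩
      obtain ⟨k, hk⟩ := he (i, w)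
      exact ⟨k, a, by rw [hk]⟩
    · rintro ⟨k, a, rfl⟩
      exact ⟨_, _, a, rfl⟩

theorem mapsTo_fullShift_sparseSet : Set.MapsTo fullShift sparseSet sparseSet := by
  rintro _ ⟨i, w, a, rfl⟩
  exact ⟨i + 1, w, a, Function.iterate_succ_apply' _ _ _⟩

theorem hasBanachDensityOne_of_mem_sparseSet {x : ℕ → Bool} (hx : x ∈ sparseSet) :
    HasBanachDensityOne {n | x n = false} := by
  obtain ⟨i, w, a, rfl⟩ := hx
  simp only [fullShift_iterate_apply]
  exact (hasBanachDensityOne_sparsePoint w a).preimage_add i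

theorem isBanachScrambled_sparseSet {m : MetricSpace (ℕ → Bool)} (hm : IsCompatibleMetric m) :
    @IsBanachScrambled _ m fullShift sparseSet := by
  refine ⟨⟨sparsePoint [] fun _ => false, ⟨0, _, _, rfl⟩, sparsePoint [] fun _ => true,
    ⟨0, _, _, rfl⟩, fun h => ?_⟩, fun x hx y hy hxy => ⟨?_, fun h => hxy ?_⟩⟩
  · have := (eq_of_eventually_shift_sparsePoint_eq (i := 0) (j := 0)
      (Filter.Eventually.of_forall fun n => congrFun h n)).2.2
    simpa using congrFun this 0
  · exact hm.isBanachProximal (hasBanachDensityOne_of_mem_sparseSet hx)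
      (hasBanachDensityOne_of_mem_sparseSet hy)
  · have h := hm.eventually_eq_of_isAsymptoticPair h
    obtain ⟨i, w, a, rfl⟩ := hx
    obtain ⟨j, v, b, rfl⟩ := hy
    obtain ⟨rfl, rfl, rfl⟩ := eq_of_eventually_shift_sparsePoint_eq h
    rfl

/-! ### Meagreness of the Banach proximal relation -/

/-- The pairs of sequences that agree somewhere in each window of length `N`. -/
def syndeticallyAgreeing (N : ℕ) : Set ((ℕ → Bool) × (ℕ → Bool)) :=
  {p | ∀ a, ∃ i < N, p.1 (a + i) = p.2 (a + i)}

theorem isClosed_syndeticallyAgreeing (N : ℕ) : IsClosed (syndeticallyAgreeing N) := by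
  have : syndeticallyAgreeing N =
      ⋂ a, ⋃ i ∈ Set.Iio N, {p | p.1 (a + i) = p.2 (a + i)} := by
    ext p
    simp [syndeticallyAgreeing]
  rw [this]
  refine isClosed_iInter fun a => (Set.finite_Iio N).isClosed_biUnion fun i _ => ?_
  exact isClosed_eq ((continuous_apply _).comp continuous_fst)
    ((continuous_apply _).comp continuous_snd)

theorem interior_syndeticallyAgreeing (N : ℕ) : interior (syndeticallyAgreeing N) = ∅ := by
  rw [interior_eq_empty_iff_dense_compl]
  rintro ⟨x, y⟩
  -- Replacing `y` by the negation of `x` from `M` on forbids agreement in the window starting at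
  -- `M`.
  refine mem_closure_of_tendsto (b := Filter.atTop)
    (f := fun M : ℕ => (x, fun n => if n < M then y n else !x n)) ?_
    (Filter.Eventually.of_forall fun M h => ?_)
  · refine tendsto_const_nhds.prodMk_nhds (tendsto_pi_nhds.2 fun i => ?_)
    refine tendsto_const_nhds.congr' ?_
    filter_upwards [Filter.eventually_gt_atTop i] with n hn
    simp [hn]
  · obtain ⟨i, -, hi⟩ := h M
    simp at hi

theorem isMeagre_iUnion_syndeticallyAgreeing : IsMeagre (⋃ N, syndeticallyAgreeing N) :=
  isMeagre_iUnion fun N => IsNowhereDense.isMeagre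
    ((isClosed_syndeticallyAgreeing N).isNowhereDense_iff.2 (interior_syndeticallyAgreeing N))

theorem banachProximalRelation_subset {m : MetricSpace (ℕ → Bool)} (hm : IsCompatibleMetric m) :
    @banachProximalRelation _ m fullShift ⊆ ⋃ N, syndeticallyAgreeing N := by
  rintro ⟨x, y⟩ h
  -- Any density strictly between `0` and `1` would do: it only has to force one agreement per
  -- window.
  obtain ⟨N, hN, H⟩ := hm.hasBanachDensityOne_of_isBanachProximal h (1 / 2) (by norm_num)
  refine Set.mem_iUnion.2 ⟨N, fun a => ?_⟩
  have h₁ := H a N le_rfl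
  have h₂ : (0 : ℝ) < N := by exact_mod_cast hN
  have h₃ : (0 : ℝ) < (({n | x n = y n} ∩ Set.Ico a (a + N)).ncard : ℝ) := by linarith
  obtain ⟨n, hn, h₄, h₅⟩ := Set.nonempty_of_ncard_ne_zero (Nat.cast_pos.1 h₃).ne'
  refine ⟨n - a, by omega, ?_⟩
  rw [Nat.add_sub_cancel' h₄]
  exact hn

theorem corollary6p6 :
    (∃ S : Set (ℕ → Bool), Dense S ∧ IsMycielskiSet S ∧ Set.MapsTo fullShift S S ∧
      ∀ m : MetricSpace (ℕ → Bool), IsCompatibleMetric m →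
        @IsBanachScrambled (ℕ → Bool) m fullShift S) ∧
    (∀ m : MetricSpace (ℕ → Bool), IsCompatibleMetric m →
      IsMeagre (@banachProximalRelation (ℕ → Bool) m fullShift)) :=
  ⟨⟨sparseSet, dense_sparseSet, isMycielskiSet_sparseSet, mapsTo_fullShift_sparseSet,
    fun _ hm => isBanachScrambled_sparseSet hm⟩,
    fun _ hm => isMeagre_iUnion_syndeticallyAgreeing.mono (banachProximalRelation_subset hm)⟩
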